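/- Let $N$ be a finite set of agents and $A$ a finite set of alternatives with $|A|\ge 3$. A preference (type) is a relation $\succcurlyeq$ on $A\times\mathbb R$ (alternative, own payment) for which there is $u:A\times\mathbb R\to\mathbb R$, strictly decreasing in the payment, with $(a,y)\succcurlyeq(b,z)\iff u(a,y)\ge u(b,z)$. A utility $u$ is quasi-linear if $u(a,z)=v(a)-z$ for some $v:A\to\mathbb R$. It pos-represents $\succcurlyeq$ if $(a,y)\succcurlyeq(b,z)\iff u(a,y)\ge u(b,z)$ whenever $u(a,y)\ge 0$ or $u(b,z)\ge 0$. For each $i\in N$ let $T_i$ be a set of types and $\varphi_i$ a bijection from $T_i$ onto the set of quasi-linear $u$ with $\min_{a\in A}u(a,0)=0$, such that every $t\in T_i$ is pos-represented by $\varphi_i(t)$. Let $(x,p)$, with $x:\prod_iT_i\to A$ and $p:\prod_iT_i\to\mathbb R^N$, be a mechanism that is onto ($x$ is surjective), incentive compatible (for all $i$, all $t$ and all $t_i'\in T_i$, the outcome $(x(t),p_i(t))$ is weakly preferred according to $t_i$ to $(x(t_i',t_{-i}),p_i(t_i',t_{-i}))$), and satisfies $p_i(t)\le\varphi_i(t_i)(x(t),0)$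 for all $t$ and $i$. Then there are $w\in[0,1]^N$ with $\sum_iw_i=1$ and $c\in\mathbb R^A$ such that, for every choice of a quasi-linear pos-representation $u_i=u_i[t_i]$ for each type $t_i\in T_i$ of each agent $i$, there are functions $h_i:\prod_{j\ne i}T_j\to\mathbb R$ such that for every profile $t$ $$x(t)\in\operatorname*{argmax}_{a\in A}\Big(c_a+\sum_{i\in N}w_i\,u_i(a,0)\Big),$$ $$p_i(t)=h_i(t_{-i})-\frac1{w_i}\Big(c_{x(t)}+\sum_{j\ne i}w_j\,u_j(x(t),0)\Big)\quad\text{for every } i \text{ with } w_i>0,$$ and, for every $i$ with $w_i=0$, $p_i(t)=h_i(t_{-i})$ provided that Agent $i$ has no influence on the chosen alternative at $t_{-i}$, i.e. $x(\cdot,t_{-i})$ is constant. Moreover, for the same $w$ and $c$, this proviso can be dropped (so $(x,p)$ is literally the VCG-like mechanism given by $A$, $w$, $c$) if $(x,p)$ is such that every agent $i$ for whom $x(\cdot,t_{-i})$ is constant for some $t_{-i}$ has this property for all $t_{-i}$. -/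

import Mathlib

namespace PosRep

/-- A preference of an agent: a binary relation on pairs (alternative, payment of the agent);
`r (a, y) (b, z)` reads "(a, y) is weakly preferred to (b, z)". -/
abbrev Pref (A : Type*) := A × ℝ → A × ℝ → Prop

/-- A cardinal function of an alternative and a payment. -/
abbrev Util (A : Type*) := A → ℝ → ℝ

/-- `u` represents the preference `r`. -/
def Represents {A : Type*} (u : Util A) (r : Pref A) : Prop :=
  ∀ (a b : A) (y z : ℝ), r (a, y) (b, z) ↔ u b z ≤ u a y

/-- `u` pos-represents the preference `r`: they agree on all comparisons in which at least one of
the two comparands has nonnegative utility. -/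
def PosRepresents {A : Type*} (u : Util A) (r : Pref A) : Prop :=
  ∀ (a b : A) (y z : ℝ), (0 ≤ u a y ∨ 0 ≤ u b z) → (r (a, y) (b, z) ↔ u b z ≤ u a y)

/-- The preferences (types) that are represented by a utility function that is strictly decreasing
in the payment. -/
def allTypes (A : Type*) : Set (Pref A) :=
  {r | ∃ u : Util A, (∀ a, StrictAnti (u a)) ∧ Represents u r}

/-- The quasi-linear utility functions `u a z = v a - z`. -/
def quasiLinear (A : Type*) : Set (Util A) :=
  {u | ∃ v : A → ℝ, ∀ a z, u a z = v a - z}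

/-- The quasi-linear utility functions with `min_a u a 0 = 0`. -/
def normalizedQL (A : Type*) : Set (Util A) :=
  {u | u ∈ quasiLinear A ∧ IsLeast (Set.range fun a => u a 0) 0}

/-- Profiles of types, one for each agent. -/
abbrev Profile {N A : Type*} (T : N → Set (Pref A)) := ∀ i, T i

/-- Profiles of types of the agents other than `i`. -/
abbrev OthersProfile {N A : Type*} (T : N → Set (Pref A)) (i : N) := ∀ j : {j : N // j ≠ i}, T j

/-- The part `t_{-i}` of the profile `t`. -/
def others {N A : Type*} {T : N → Set (Pref A)} (i : N) (t : Profile T) : OthersProfile T i :=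
  fun j => t j

/-- A direct mechanism with monetary transfers: a chosen alternative and a payment of each agent,
as functions of the reported types. -/
structure Mechanism {N A : Type*} (T : N → Set (Pref A)) where
  x : Profile T → A
  p : Profile T → N → ℝ

section

variable {N A : Type*} [DecidableEq N] {T : N → Set (Pref A)}

/-- Every alternative is the outcome of some report vector. -/
def Mechanism.Onto (M : Mechanism T) : Prop := Function.Surjective M.x

/-- Truthful reporting is best for each agent, according to her true preference `t i`, whatever the
others report. -/
def Mechanism.IncentiveCompatible (M : Mechanism T) : Prop :=
  ∀ (i : N) (t : Profile T) (s : T i),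
    (t i : Pref A) (M.x t, M.p t i)
      (M.x (Function.update t i s), M.p (Function.update t i s) i)

/-- Given the reports `t_{-i}` of the others, the report of agent `i` has no influence on the
chosen alternative. -/
def Mechanism.NoInfluence (M : Mechanism T) (i : N) (t : Profile T) : Prop :=
  ∀ s : T i, M.x (Function.update t i s) = M.x t

/-- Influence does not occur at some profiles only: an agent who has no influence on the chosen
alternative at some profile of the others' reports has none at any profile. -/
def Mechanism.InfluenceDichotomy (M : Mechanism T) : Prop :=
  ∀ i : N, (∃ t, M.NoInfluence i t) → ∀ t, M.NoInfluence i t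

/-- A choice of a quasi-linear pos-representation for every type of every agent. -/
def IsPosRepSelection (u : ∀ i, T i → Util A) : Prop :=
  ∀ (i : N) (s : T i), u i s ∈ quasiLinear A ∧ PosRepresents (u i s) (s : Pref A)

variable [Fintype N]

/-- The chosen alternative lies in `argmax_{a ∈ A'} (c a + ∑ i, w i * u i a 0)`. -/
def Mechanism.ChoosesArgmax (M : Mechanism T) (A' : Set A) (w : N → ℝ) (c : A → ℝ)
    (u : ∀ i, T i → Util A) (t : Profile T) : Prop :=
  M.x t ∈ A' ∧ ∀ a ∈ A',
    c a + ∑ i, w i * u i (t i) a 0 ≤ c (M.x t) + ∑ i, w i * u i (t i) (M.x t) 0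

open Classical in
/-- The payment prescribed for agent `i`:
`h i t_{-i} - (1 / w i) * (c x + ∑ j ≠ i, w j * u j x 0)` at the chosen alternative `x` if
`0 < w i`, and `h i t_{-i}` otherwise (that is, if `w i = 0`). -/
noncomputable def Mechanism.vcgPayment (M : Mechanism T) (w : N → ℝ) (c : A → ℝ)
    (u : ∀ i, T i → Util A) (h : ∀ i, OthersProfile T i → ℝ) (t : Profile T) (i : N) : ℝ :=
  if 0 < w i then
    h i (others i t) -
      1 / w i * (c (M.x t) + ∑ j ∈ Finset.univ.erase i, w j * u j (t j) (M.x t) 0)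
  else h i (others i t)

/-- `M` is the VCG-like mechanism for pos-represented types with alternatives `A'`, agent weights
`w` and alternative costs `c`. The choice of the pos-representations is arbitrary: whichever
selection `u` is made, the chosen alternative is a maximizer, and the payments have the prescribed
form for some functions `h i` of the reports of the others. -/
def Mechanism.IsPosRepVCG (M : Mechanism T) (A' : Set A) (w : N → ℝ) (c : A → ℝ) : Prop :=
  ∀ u : ∀ i, T i → Util A, IsPosRepSelection u →
    ∃ h : ∀ i, OthersProfile T i → ℝ, ∀ t : Profile T,
      M.ChoosesArgmax A' w c u t ∧ ∀ i, M.p t i = M.vcgPayment w c u h t i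

/-- The same, except that the payment of an agent of weight zero is prescribed only where she has
no influence on the chosen alternative (she may have influence where maximizers are tied). -/
def Mechanism.IsPosRepVCGUpToNullTies (M : Mechanism T) (A' : Set A) (w : N → ℝ) (c : A → ℝ) :
    Prop :=
  ∀ u : ∀ i, T i → Util A, IsPosRepSelection u →
    ∃ h : ∀ i, OthersProfile T i → ℝ, ∀ t : Profile T,
      M.ChoosesArgmax A' w c u t ∧
      ∀ i, (0 < w i ∨ M.NoInfluence i t) → M.p t i = M.vcgPayment w c u h t i

end

end PosRep

/-! The payment bound makes every truthful outcome nonnegative in utility, so pos-representation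
turns incentive compatibility into ordinary quasi-linear incentive compatibility for the `φ i`.
Since the `φ i` are onto, every valuation is realized up to an additive constant, and the choice
rule becomes a weakly monotone function on the unrestricted domain. Roberts' theorem
(`exists_affine_maximizer`) then yields `w` and `c`: translated to a common threshold, the
difference sets of all pairs are one open convex set missing the origin, and a separating hyperplane
gives the weights (`exists_weights`).

Payments of agents of positive weight follow from revenue equivalence (`payment_sub_eq`), those of
agents without influence from the taxation principle (`payment_eq`). Other pos-representations
differ only by constants (`exists_add_const`), which are absorbed in `h`. An agent of weight zero
lacks influence somewhere (`exists_noInfluence`), hence everywhere under the dichotomy. -/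

namespace PosRep

/-! ### Difference families, their thresholds and their weights -/

/-- The laws of the sets of vectors of utility differences between `x` and `y` at which `x` beats
`y` robustly. -/
structure IsDifferenceFamily {N A : Type*} (P : A → A → Set (N → ℝ)) : Prop where
  nonempty : ∀ x y, x ≠ y → (P x y).Nonempty
  upper : ∀ x y, ∀ α ∈ P x y, ∀ β, α ≤ β → β ∈ P x y
  sub_mem : ∀ x y, ∀ α ∈ P x y, ∃ e : ℝ, 0 < e ∧ (fun i => α i - e) ∈ P x y
  asymm : ∀ x y, x ≠ y → ∀ α ∈ P x y, -α ∉ P y x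
  total : ∀ x y, x ≠ y → ∀ α, α ∉ P x y → ∀ e : ℝ, 0 < e → (fun i => -α i + e) ∈ P y x
  add_mem : ∀ x y z, x ≠ y → y ≠ z → x ≠ z → ∀ α ∈ P x y, ∀ β ∈ P y z, α + β ∈ P x z

namespace IsDifferenceFamily

variable {N A : Type*} {P : A → A → Set (N → ℝ)}

/-- The least uniform difference from which on `x` beats `y`. -/
noncomputable def threshold (P : A → A → Set (N → ℝ)) (x y : A) : ℝ :=
  sInf {p : ℝ | (fun _ => p) ∈ P x y}

/-- The difference sets, translated so that their threshold is zero. -/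
def shifted (P : A → A → Set (N → ℝ)) (x y : A) : Set (N → ℝ) :=
  {α | (fun i => α i + threshold P x y) ∈ P x y}

lemma exists_const_mem [Finite N] (h : IsDifferenceFamily P) {x y : A} (hxy : x ≠ y) :
    ∃ p : ℝ, (fun _ => p) ∈ P x y := by
  obtain ⟨α, hα⟩ := h.nonempty x y hxy
  obtain ⟨p, hp⟩ := (Set.finite_range α).bddAbove
  exact ⟨p, h.upper x y α hα _ fun i => hp ⟨i, rfl⟩⟩

lemma bddBelow_const [Finite N] (h : IsDifferenceFamily P) {x y : A} (hxy : x ≠ y) :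
    BddBelow {p : ℝ | (fun _ => p) ∈ P x y} := by
  obtain ⟨q, hq⟩ := h.exists_const_mem hxy.symm
  refine ⟨-q, fun p hp => ?_⟩
  by_contra hlt
  push Not at hlt
  exact h.asymm x y hxy _ hp (h.upper y x _ hq _ fun i => by
    simp only [Pi.neg_apply]; linarith)

lemma const_mem_iff [Finite N] (h : IsDifferenceFamily P) {x y : A} (hxy : x ≠ y) (p : ℝ) :
    (fun _ => p) ∈ P x y ↔ threshold P x y < p := by
  constructor
  · intro hp
    obtain ⟨e, he, hpe⟩ := h.sub_mem x y _ hp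
    have := csInf_le (h.bddBelow_const hxy) hpe
    unfold threshold
    linarith
  · intro hp
    obtain ⟨q, hq, hqp⟩ := exists_lt_of_csInf_lt (h.exists_const_mem hxy) hp
    exact h.upper x y _ hq _ fun i => hqp.le

lemma threshold_symm [Finite N] (h : IsDifferenceFamily P) {x y : A} (hxy : x ≠ y) :
    threshold P y x = -threshold P x y := by
  apply le_antisymm
  · refine le_of_forall_pos_le_add fun e he => ?_
    have h1 : (fun _ : N => threshold P x y) ∉ P x y := by
      rw [h.const_mem_iff hxy]; exact lt_irrefl _
    exact ((h.const_mem_iff hxy.symm _).1 (h.total x y hxy _ h1 e he)).le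
  · refine le_of_forall_pos_le_add fun e he => ?_
    have h1 := (h.const_mem_iff hxy (threshold P x y + e)).2 (by linarith)
    have h2 := h.asymm x y hxy _ h1
    have h3 := mt (h.const_mem_iff hxy.symm (-(threshold P x y + e))).2 h2
    linarith

lemma threshold_add_le [Finite N] (h : IsDifferenceFamily P) {x y z : A} (hxy : x ≠ y)
    (hyz : y ≠ z) (hxz : x ≠ z) :
    threshold P x z ≤ threshold P x y + threshold P y z := by
  refine le_of_forall_pos_le_add fun e he => ?_
  have h1 := (h.const_mem_iff hxy (threshold P x y + e / 2)).2 (by linarith)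
  have h2 := (h.const_mem_iff hyz (threshold P y z + e / 2)).2 (by linarith)
  have h3 : threshold P x z < (threshold P x y + e / 2) + (threshold P y z + e / 2) :=
    (h.const_mem_iff hxz _).1 (h.add_mem x y z hxy hyz hxz _ h1 _ h2)
  linarith

/-- The reverse inequality is the triangle inequality for the reversed pairs, by antisymmetry.
Additivity is what makes thresholds differences of costs. -/
lemma threshold_add [Finite N] (h : IsDifferenceFamily P) {x y z : A} (hxy : x ≠ y)
    (hyz : y ≠ z) (hxz : x ≠ z) :
    threshold P x z = threshold P x y + threshold P y z := by
  apply le_antisymm (h.threshold_add_le hxy hyz hxz)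
  have h1 := h.threshold_add_le hyz.symm hxy.symm hxz.symm
  rw [h.threshold_symm hxy, h.threshold_symm hyz, h.threshold_symm hxz] at h1
  linarith

lemma shifted_add [Finite N] (h : IsDifferenceFamily P) {x y z : A} (hxy : x ≠ y)
    (hyz : y ≠ z) (hxz : x ≠ z) {α β : N → ℝ} (hα : α ∈ shifted P x y)
    (hβ : β ∈ shifted P y z) : α + β ∈ shifted P x z := by
  have h1 := h.add_mem x y z hxy hyz hxz _ hα _ hβ
  refine h.upper x z _ h1 _ fun i => ?_
  simp only [Pi.add_apply, h.threshold_add hxy hyz hxz]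
  linarith

lemma shifted_upper (h : IsDifferenceFamily P) {x y : A} {α β : N → ℝ}
    (hα : α ∈ shifted P x y) (hle : α ≤ β) : β ∈ shifted P x y :=
  h.upper x y _ hα _ fun i => by linarith [hle i]

lemma const_mem_shifted [Finite N] (h : IsDifferenceFamily P) {x y : A} (hxy : x ≠ y) {e : ℝ}
    (he : 0 < e) : (fun _ => e) ∈ shifted P x y :=
  (h.const_mem_iff hxy _).2 (by linarith)

lemma shifted_sub_mem (h : IsDifferenceFamily P) {x y : A} {α : N → ℝ}
    (hα : α ∈ shifted P x y) : ∃ e : ℝ, 0 < e ∧ (fun i => α i - e) ∈ shifted P x y := by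
  obtain ⟨e, he, hm⟩ := h.sub_mem x y _ hα
  refine ⟨e, he, h.upper x y _ hm _ fun i => ?_⟩
  simp only
  linarith

lemma shifted_subset_right [Finite N] (h : IsDifferenceFamily P) {x y z : A} (hxy : x ≠ y)
    (hxz : x ≠ z) : shifted P x y ⊆ shifted P x z := by
  intro α hα
  by_cases hyz : y = z
  · exact hyz ▸ hα
  obtain ⟨e, he, hm⟩ := h.shifted_sub_mem hα
  refine h.shifted_upper (h.shifted_add hxy hyz hxz hm (h.const_mem_shifted hyz he)) fun i => ?_
  simp

lemma shifted_subset_left [Finite N] (h : IsDifferenceFamily P) {x y z : A} (hxy : x ≠ y)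
    (hzy : z ≠ y) : shifted P x y ⊆ shifted P z y := by
  intro α hα
  by_cases hxz : x = z
  · exact hxz ▸ hα
  obtain ⟨e, he, hm⟩ := h.shifted_sub_mem hα
  refine h.shifted_upper
    (h.shifted_add (Ne.symm hxz) hxy hzy (h.const_mem_shifted (Ne.symm hxz) he) hm) fun i => ?_
  simp

/-- Each endpoint can be replaced separately. If `x = y'`, replacing the second one first would give
a degenerate pair, so the route detours through a third alternative. -/
lemma shifted_subset [Finite N] (h : IsDifferenceFamily P)
    (h3 : ∀ x y : A, ∃ z, z ≠ x ∧ z ≠ y) {x y x' y' : A} (hxy : x ≠ y) (hxy' : x' ≠ y') :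
    shifted P x y ⊆ shifted P x' y' := by
  by_cases hx : x = y'
  · subst hx
    obtain ⟨z, hzx, hzx'⟩ := h3 x x'
    exact ((h.shifted_subset_right hxy hzx.symm).trans
      (h.shifted_subset_left hzx.symm hzx'.symm)).trans (h.shifted_subset_right hzx'.symm hxy')
  · exact (h.shifted_subset_right hxy hx).trans (h.shifted_subset_left hx hxy')

lemma zero_notMem_shifted [Finite N] (h : IsDifferenceFamily P) {x y : A} (hxy : x ≠ y) :
    (0 : N → ℝ) ∉ shifted P x y := by
  intro h0
  have h1 := (h.const_mem_iff hxy (0 + threshold P x y)).1 h0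
  linarith

lemma shifted_add_self [Finite N] (h : IsDifferenceFamily P)
    (h3 : ∀ x y : A, ∃ z, z ≠ x ∧ z ≠ y) {x y : A} (hxy : x ≠ y) {α β : N → ℝ}
    (hα : α ∈ shifted P x y) (hβ : β ∈ shifted P x y) : α + β ∈ shifted P x y := by
  obtain ⟨z, hzx, hzy⟩ := h3 x y
  exact h.shifted_add hzx.symm hzy hxy (h.shifted_subset h3 hxy hzx.symm hα)
    (h.shifted_subset h3 hxy hzy hβ)

lemma shifted_total [Finite N] (h : IsDifferenceFamily P)
    (h3 : ∀ x y : A, ∃ z, z ≠ x ∧ z ≠ y) {x y : A} (hxy : x ≠ y) {α : N → ℝ}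
    (hα : α ∉ shifted P x y) {e : ℝ} (he : 0 < e) : (fun i => -α i + e) ∈ shifted P x y := by
  have h1 := h.total x y hxy _ hα e he
  refine h.shifted_subset h3 hxy.symm hxy (h.upper y x _ h1 _ fun i => ?_)
  simp only [h.threshold_symm hxy]
  linarith

lemma shifted_nsmul [Finite N] (h : IsDifferenceFamily P)
    (h3 : ∀ x y : A, ∃ z, z ≠ x ∧ z ≠ y) {x y : A} (hxy : x ≠ y) {α : N → ℝ}
    (hα : α ∈ shifted P x y) (n : ℕ) : ((n + 1 : ℕ) : ℝ) • α ∈ shifted P x y := by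
  induction n with
  | zero => simpa using hα
  | succ n ih =>
    have := h.shifted_add_self h3 hxy ih hα
    convert this using 1
    push_cast
    module

/-- Otherwise totality puts `(-α + e) / (n + 1)` in the set, hence `-α + e`; adding `α - e` would
give the excluded origin. -/
lemma shifted_inv_smul [Finite N] (h : IsDifferenceFamily P)
    (h3 : ∀ x y : A, ∃ z, z ≠ x ∧ z ≠ y) {x y : A} (hxy : x ≠ y) {α : N → ℝ}
    (hα : α ∈ shifted P x y) (n : ℕ) : ((n + 1 : ℕ) : ℝ)⁻¹ • α ∈ shifted P x y := by
  by_contra hn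
  obtain ⟨e, he, hm⟩ := h.shifted_sub_mem hα
  have hpos : (0 : ℝ) < ((n + 1 : ℕ) : ℝ) := by positivity
  have h1 := h.shifted_nsmul h3 hxy
    (h.shifted_total h3 hxy hn (e := e / ((n + 1 : ℕ) : ℝ)) (by positivity)) n
  refine h.zero_notMem_shifted hxy (h.shifted_upper (h.shifted_add_self h3 hxy hm h1) ?_)
  intro i
  simp only [Pi.add_apply, Pi.smul_apply, smul_eq_mul, Pi.zero_apply]
  apply le_of_eq
  field_simp
  ring

/-- Openness leaves room to replace `r` by a rational: `q • (α - e)` lies below `r • α` once `(r -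
q) * (|B| + 1) ≤ r * e / 2 ≤ q * e`. -/
lemma shifted_smul [Finite N] (h : IsDifferenceFamily P)
    (h3 : ∀ x y : A, ∃ z, z ≠ x ∧ z ≠ y) {x y : A} (hxy : x ≠ y) {α : N → ℝ}
    (hα : α ∈ shifted P x y) {r : ℝ} (hr : 0 < r) : r • α ∈ shifted P x y := by
  obtain ⟨e, he, hm⟩ := h.shifted_sub_mem hα
  obtain ⟨B, hB⟩ := (Set.finite_range fun i => |α i|).bddAbove
  -- a rational number `q` slightly below `r`
  obtain ⟨q, hq1, hq2⟩ := exists_rat_btwn (show max (r / 2) (r - r * e / (2 * (|B| + 1))) < r from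
    max_lt (by linarith) (by have : 0 < r * e / (2 * (|B| + 1)) := by positivity
                             linarith))
  obtain ⟨hq3, hq4⟩ := max_lt_iff.1 hq1
  have hq0 : (0 : ℝ) < q := by linarith
  have hq0' : 0 < q := by exact_mod_cast hq0
  have hmem : (q : ℝ) • (fun i => α i - e) ∈ shifted P x y := by
    have h1 := h.shifted_nsmul h3 hxy (h.shifted_inv_smul h3 hxy hm (q.den - 1)) (q.num.natAbs - 1)
    have hd : q.den - 1 + 1 = q.den := Nat.sub_add_cancel q.den_pos
    have hn : q.num.natAbs - 1 + 1 = q.num.natAbs :=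
      Nat.sub_add_cancel (Int.natAbs_pos.2 (Rat.num_pos.2 hq0').ne')
    rw [hd, hn, smul_smul] at h1
    convert h1 using 2
    rw [Nat.cast_natAbs, abs_of_pos (Rat.num_pos.2 hq0'), ← div_eq_mul_inv]
    exact Rat.cast_def q
  refine h.shifted_upper hmem fun i => ?_
  simp only [Pi.smul_apply, smul_eq_mul]
  have hαB : -(|B| + 1) ≤ α i := by
    have h1 : |α i| ≤ B := hB ⟨i, rfl⟩
    linarith [neg_abs_le (α i), le_abs_self B]
  have hd : (r - q) * (2 * (|B| + 1)) ≤ r * e := by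
    have : r - q ≤ r * e / (2 * (|B| + 1)) := by linarith
    rwa [le_div_iff₀ (by positivity)] at this
  nlinarith [mul_le_mul_of_nonneg_left hαB (sub_nonneg.2 hq2.le),
    mul_le_mul_of_nonneg_right hq3.le he.le]

lemma convex_shifted [Finite N] (h : IsDifferenceFamily P)
    (h3 : ∀ x y : A, ∃ z, z ≠ x ∧ z ≠ y) {x y : A} (hxy : x ≠ y) :
    Convex ℝ (shifted P x y) :=
  convex_iff_forall_pos.2 fun _ hα _ hβ _ _ ha hb _ =>
    h.shifted_add_self h3 hxy (h.shifted_smul h3 hxy hα ha) (h.shifted_smul h3 hxy hβ hb)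

lemma isOpen_shifted [Fintype N] (h : IsDifferenceFamily P) (x y : A) :
    IsOpen (shifted P x y) := by
  refine Metric.isOpen_iff.2 fun α hα => ?_
  obtain ⟨e, he, hm⟩ := h.shifted_sub_mem hα
  refine ⟨e, he, fun β hβ => h.shifted_upper hm fun i => ?_⟩
  have h1 : dist (β i) (α i) < e := (dist_le_pi_dist β α i).trans_lt hβ
  rw [Real.dist_eq, abs_lt] at h1
  simp only
  linarith [h1.1]

/-- The common translate of the difference sets lies in the half-space of a weight vector. -/
lemma exists_weights [Fintype N] (h : IsDifferenceFamily P)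
    (h3 : ∀ x y : A, ∃ z, z ≠ x ∧ z ≠ y) {x y : A} (hxy : x ≠ y) :
    ∃ w ∈ stdSimplex ℝ N, ∀ α ∈ shifted P x y, 0 ≤ ∑ i, w i * α i := by
  classical
  obtain ⟨f, hf⟩ := geometric_hahn_banach_open_point (h.convex_shifted h3 hxy)
    (h.isOpen_shifted x y) (h.zero_notMem_shifted hxy)
  simp only [map_zero] at hf
  have hsum : ∀ α : N → ℝ, f α = ∑ i, α i * f (Pi.single i 1) := fun α => by
    conv_lhs => rw [pi_eq_sum_univ' α]
    simp only [map_sum, map_smul, smul_eq_mul]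
  have hone : f (fun _ => 1) < 0 := hf _ (h.const_mem_shifted hxy one_pos)
  have hnonpos : ∀ i, f (Pi.single i 1) ≤ 0 := by
    intro i
    by_contra hpos
    push Not at hpos
    -- The multiple of the basis vector is chosen so that `f` vanishes at a point of the upward
    -- closed set, where it must be negative.
    have hmem : (fun _ => (1 : ℝ)) + (-f (fun _ => 1) / f (Pi.single i 1)) • Pi.single i 1
        ∈ shifted P x y := by
      refine h.shifted_upper (h.const_mem_shifted hxy one_pos) fun j => ?_
      have h1 : 0 ≤ -f (fun _ => 1) / f (Pi.single i 1) := div_nonneg (by linarith) hpos.le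
      have h2 : (0 : ℝ) ≤ (Pi.single i 1 : N → ℝ) j :=
        (Pi.single_nonneg.2 zero_le_one : (0 : N → ℝ) ≤ Pi.single i 1) j
      simpa using mul_nonneg h1 h2
    have := hf _ hmem
    rw [map_add, map_smul, smul_eq_mul, div_mul_cancel₀ _ hpos.ne'] at this
    linarith
  refine ⟨fun i => f (Pi.single i 1) / f (fun _ => 1),
    ⟨fun i => div_nonneg_of_nonpos (hnonpos i) hone.le, ?_⟩, fun α hα => ?_⟩
  · rw [← Finset.sum_div, div_eq_one_iff_eq hone.ne, hsum fun _ => 1]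
    simp
  · have h1 : ∑ i, f (Pi.single i 1) / f (fun _ => 1) * α i = f α / f (fun _ => 1) := by
      rw [hsum α, Finset.sum_div]
      exact Finset.sum_congr rfl fun i _ => by ring
    rw [h1]
    exact div_nonneg_of_nonpos (hf _ hα).le hone.le

theorem exists_weights_costs [Fintype N] [Nonempty A] (h : IsDifferenceFamily P)
    (h3 : ∀ x y : A, ∃ z, z ≠ x ∧ z ≠ y) :
    ∃ w ∈ stdSimplex ℝ N, ∃ c : A → ℝ, ∀ x y, x ≠ y → ∀ α ∈ P x y,
      c y - c x ≤ ∑ i, w i * α i := by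
  classical
  obtain ⟨a⟩ := ‹Nonempty A›
  obtain ⟨b, hba, -⟩ := h3 a a
  obtain ⟨w, hw, hpos⟩ := h.exists_weights h3 hba
  -- Costs are thresholds against the base point `a`; its own cost is set to zero because nothing is
  -- known of the degenerate `threshold P a a`.
  refine ⟨w, hw, fun x => if x = a then 0 else -threshold P x a, fun x y hxy α hα => ?_⟩
  have hc : (if y = a then 0 else -threshold P y a) - (if x = a then 0 else -threshold P x a) =
      threshold P x y := by
    split_ifs with h1 h2 h2
    · exact absurd (h2.trans h1.symm) hxy
    · rw [h1]; ring
    · rw [h2, h.threshold_symm (Ne.symm h1)]; ring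
    · rw [h.threshold_add hxy h1 h2]; ring
  rw [hc]
  have hmem : (fun i => α i - threshold P x y) ∈ shifted P x y :=
    h.upper x y _ hα _ fun i => by simp
  have h1 := hpos _ (h.shifted_subset h3 hxy hba hmem)
  simp only [mul_sub, Finset.sum_sub_distrib, ← Finset.sum_mul, hw.2, one_mul] at h1
  linarith

end IsDifferenceFamily

/-! ### Roberts' theorem for weakly monotone functions -/

/-- Weak monotonicity of a social choice function on the unrestricted domain of valuations. -/
def WeaklyMonotone {N A : Type*} [DecidableEq N] (f : (N → A → ℝ) → A) : Prop :=
  ∀ (v : N → A → ℝ) (i : N) (s : A → ℝ),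
    s (f v) - v i (f v) ≤ s (f (Function.update v i s)) - v i (f (Function.update v i s))

/-- Utility differences between `x` and `y` above some vector at which `x` is chosen. -/
def differenceSet {N A : Type*} (f : (N → A → ℝ) → A) (x y : A) : Set (N → ℝ) :=
  {α | ∃ e : ℝ, 0 < e ∧ ∃ v, f v = x ∧ ∀ i, v i x - v i y + e ≤ α i}

lemma exists_const_mem_differenceSet {N A : Type*} [Finite N] [Finite A]
    {f : (N → A → ℝ) → A} (honto : Function.Surjective f) :
    ∃ B : ℝ, ∀ x y, (fun _ => B) ∈ differenceSet f x y := by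
  choose v hv using honto
  obtain ⟨B, hB⟩ := (Set.finite_range fun q : A × A × N =>
    v q.1 q.2.2 q.1 - v q.1 q.2.2 q.2.1 + 1).bddAbove
  exact ⟨B, fun x y => ⟨1, one_pos, v x, hv x, fun i => hB ⟨(x, y, i), rfl⟩⟩⟩

namespace WeaklyMonotone

variable {N A : Type*} [Fintype N] [DecidableEq N] {f : (N → A → ℝ) → A}

/-- Positive association of differences. -/
lemma positive_association (hf : WeaklyMonotone f) (v v' : N → A → ℝ)
    (h : ∀ i y, y ≠ f v → v' i y - v i y < v' i (f v) - v i (f v)) : f v' = f v := by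
  have key : ∀ s : Finset N, f (s.piecewise v' v) = f v := by
    intro s
    induction s using Finset.induction_on with
    | empty => simp
    | insert i s hi ih =>
      rw [Finset.piecewise_insert]
      by_contra hne
      have h1 := hf (s.piecewise v' v) i (v' i)
      rw [ih, Finset.piecewise_eq_of_notMem _ _ _ hi] at h1
      linarith [h i _ hne]
  simpa using key Finset.univ

lemma not_forall_diff_lt (hf : WeaklyMonotone f) {v u : N → A → ℝ} (hne : f v ≠ f u) :
    ¬ ∀ i, v i (f v) - v i (f u) < u i (f v) - u i (f u) := by
  classical
  intro hlt
  set x := f v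
  set y := f u
  -- The profile `r` has an intermediate difference between `x` and `y` and low values elsewhere, so
  -- positive association from `v` forces `x` and from `u` forces `y`.
  set m : N → ℝ := fun i => ((v i x - v i y) + (u i x - u i y)) / 2
  set r : N → A → ℝ := fun i z => if z = x then m i else if z = y then 0 else
    min (m i - v i x + v i z) (-u i y + u i z) - 1 with hr
  have hmi : ∀ i, m i = ((v i x - v i y) + (u i x - u i y)) / 2 := fun _ => rfl
  have hrx : ∀ i, r i x = m i := fun i => by simp [hr]
  have hry : ∀ i, r i y = 0 := fun i => by simp [hr, hne.symm]
  have hrz : ∀ i z, z ≠ x → z ≠ y →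
      r i z = min (m i - v i x + v i z) (-u i y + u i z) - 1 := fun i z h1 h2 => by
    simp [hr, h1, h2]
  have h1 : f r = x := hf.positive_association v r fun i z hz => by
    change z ≠ x at hz
    change _ < r i x - v i x
    by_cases hzy : z = y
    · rw [hzy, hrx, hry]
      linarith [hlt i, hmi i]
    · rw [hrx, hrz i z hz hzy]
      linarith [min_le_left (m i - v i x + v i z) (-u i y + u i z)]
  have h2 : f r = y := hf.positive_association u r fun i z hz => by
    change z ≠ y at hz
    change _ < r i y - u i y
    by_cases hzx : z = x
    · rw [hzx, hrx, hry]
      linarith [hlt i, hmi i]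
    · rw [hry, hrz i z hzx hz]
      linarith [min_le_right (m i - v i x + v i z) (-u i y + u i z)]
  exact hne (h1.symm.trans h2)

lemma apply_ne_of_mem_differenceSet (hf : WeaklyMonotone f) {x y : A} (hxy : x ≠ y)
    {α : N → ℝ} (hα : α ∈ differenceSet f x y) {u : N → A → ℝ}
    (hu : ∀ i, α i ≤ u i x - u i y) : f u ≠ y := by
  rintro rfl
  obtain ⟨e, he, v, rfl, hv⟩ := hα
  exact hf.not_forall_diff_lt hxy fun i => by linarith [hv i, hu i]

lemma isDifferenceFamily [Finite A] (hf : WeaklyMonotone f) (honto : Function.Surjective f) :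
    IsDifferenceFamily (differenceSet f) := by
  classical
  obtain ⟨B, hB⟩ := exists_const_mem_differenceSet honto
  have hsub : ∀ x y, ∀ α ∈ differenceSet f x y,
      ∃ e : ℝ, 0 < e ∧ (fun i => α i - e) ∈ differenceSet f x y := by
    rintro x y α ⟨e, he, v, hv, hle⟩
    exact ⟨e / 2, by linarith, e / 2, by linarith, v, hv, fun i => by linarith [hle i]⟩
  have hupper : ∀ x y, ∀ α ∈ differenceSet f x y, ∀ β, α ≤ β → β ∈ differenceSet f x y := by
    rintro x y α ⟨e, he, v, hv, hle⟩ β hβ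
    exact ⟨e, he, v, hv, fun i => (hle i).trans (hβ i)⟩
  refine ⟨fun x y _ => ⟨_, hB x y⟩, hupper, hsub, ?_, ?_, ?_⟩
  · rintro x y hxy α hα ⟨e, he, v, hv, hle⟩
    refine hf.apply_ne_of_mem_differenceSet hxy hα (u := v) (fun i => ?_) hv
    have := hle i
    simp only [Pi.neg_apply] at this
    linarith
  · intro x y hxy α hα e he
    -- Every third alternative lies `B` below `x`, so it cannot be chosen; `x` cannot either, as `α`
    -- would then be in its difference set.
    set v : N → A → ℝ := fun i z => if z = x then α i - e / 2 else if z = y then 0 else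
      α i - e / 2 - B with hv
    have hvx : ∀ i, v i x = α i - e / 2 := fun i => by simp [hv]
    have hvy : ∀ i, v i y = 0 := fun i => by simp [hv, hxy.symm]
    have hx : f v ≠ x := fun hfx =>
      hα ⟨e / 2, by linarith, v, hfx, fun i => by rw [hvx, hvy]; linarith⟩
    have hy : f v = y := by
      by_contra hy
      refine hf.apply_ne_of_mem_differenceSet hx.symm (hB x (f v)) (u := v) (fun i => ?_) rfl
      have : v i (f v) = α i - e / 2 - B := by
        simp only [hv]
        rw [if_neg hx, if_neg hy]
      rw [hvx, this]
      linarith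
    exact ⟨e / 2, by linarith, v, hy, fun i => by rw [hvx, hvy]; linarith⟩
  · intro x y z hxy hyz hxz α hα β hβ
    obtain ⟨e, he, hα'⟩ := hsub x y α hα
    obtain ⟨d, hd, hβ'⟩ := hsub y z β hβ
    set v : N → A → ℝ := fun i a => if a = x then α i - e else if a = y then 0 else
      if a = z then -(β i - d) else α i - e - B with hv
    have hvx : ∀ i, v i x = α i - e := fun i => by simp [hv]
    have hvy : ∀ i, v i y = 0 := fun i => by simp [hv, hxy.symm]
    have hvz : ∀ i, v i z = -(β i - d) := fun i => by simp [hv, hxz.symm, hyz.symm]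
    have hy : f v ≠ y :=
      hf.apply_ne_of_mem_differenceSet hxy hα' fun i => by rw [hvx, hvy]; linarith
    have hz : f v ≠ z :=
      hf.apply_ne_of_mem_differenceSet hyz hβ' fun i => by rw [hvy, hvz]; linarith
    have hx : f v = x := by
      by_contra hx
      refine hf.apply_ne_of_mem_differenceSet (Ne.symm hx) (hB x (f v)) (u := v)
        (fun i => ?_) rfl
      have : v i (f v) = α i - e - B := by
        simp only [hv]
        rw [if_neg hx, if_neg hy, if_neg hz]
      rw [hvx, this]
      linarith
    exact ⟨e + d, by linarith, v, hx, fun i => by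
      rw [hvx, hvz]; simp only [Pi.add_apply]; linarith⟩

/-- Roberts' theorem: on the unrestricted domain, a weakly monotone function onto at least three
alternatives is an affine maximizer. -/
theorem exists_affine_maximizer [Fintype A] (hA : 3 ≤ Fintype.card A) (hf : WeaklyMonotone f)
    (honto : Function.Surjective f) :
    ∃ w ∈ stdSimplex ℝ N, ∃ c : A → ℝ, ∀ v a,
      c a + ∑ i, w i * v i a ≤ c (f v) + ∑ i, w i * v i (f v) := by
  classical
  have h3 : ∀ x y : A, ∃ z, z ≠ x ∧ z ≠ y := fun x y => by
    obtain ⟨z, hz⟩ := Finset.exists_mem_notMem_of_card_lt_card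
      (s := {x, y}) (t := Finset.univ) (lt_of_le_of_lt Finset.card_le_two
        (lt_of_lt_of_le (by norm_num) (Finset.card_univ (α := A) ▸ hA)))
    exact ⟨z, by simpa [not_or] using hz.2⟩
  have : Nonempty A := Fintype.card_pos_iff.1 (by omega)
  obtain ⟨w, hw, c, hc⟩ := (hf.isDifferenceFamily honto).exists_weights_costs h3
  refine ⟨w, hw, c, fun v a => ?_⟩
  by_cases ha : f v = a
  · rw [ha]
  refine le_of_forall_pos_le_add fun e he => ?_
  have h1 := hc (f v) a ha (fun i => v i (f v) - v i a + e) ⟨e, he, v, rfl, fun i => le_rfl⟩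
  simp only [mul_add, mul_sub, Finset.sum_add_distrib, Finset.sum_sub_distrib,
    ← Finset.sum_mul, hw.2, one_mul] at h1
  linarith

end WeaklyMonotone

end PosRep

namespace PosRep

/-! ### Reduction to quasi-linear incentives; payments -/

/-- Two quasi-linear pos-representations of a preference differ by a constant. -/
lemma exists_add_const {A : Type*} {r : Pref A} {u u' : Util A} (hu : u ∈ quasiLinear A)
    (hr : PosRepresents u r) (hu' : u' ∈ quasiLinear A) (hr' : PosRepresents u' r) :
    ∃ k : ℝ, ∀ a, u a 0 = u' a 0 + k := by
  obtain ⟨v, hv⟩ := hu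
  obtain ⟨v', hv'⟩ := hu'
  rcases isEmpty_or_nonempty A with hA | ⟨⟨b⟩⟩
  · exact ⟨0, fun a => hA.elim a⟩
  refine ⟨v b - v' b, fun a => ?_⟩
  -- At this payment `a` has nonnegative utility under both representations, so an indifference
  -- between `a` and `b` carries over from one to the other.
  set y : ℝ := min (v a) (v' a) with hy
  have h1 : y ≤ v a := min_le_left _ _
  have h2 : y ≤ v' a := min_le_right _ _
  have hab := (hr a b y (y - v a + v b) (Or.inl (by rw [hv]; linarith))).2
    (by rw [hv, hv]; linarith)
  have hba := (hr b a (y - v a + v b) y (Or.inr (by rw [hv]; linarith))).2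
    (by rw [hv, hv]; linarith)
  have hab' := (hr' a b y (y - v a + v b) (Or.inl (by rw [hv']; linarith))).1 hab
  have hba' := (hr' b a (y - v a + v b) y (Or.inr (by rw [hv']; linarith))).1 hba
  rw [hv', hv'] at hab' hba'
  rw [hv, hv']
  linarith

/-- The quasi-linear utility of the valuation `v`, shifted to have minimum zero. -/
noncomputable def normalize {A : Type*} [Finite A] [Nonempty A] (v : A → ℝ) : normalizedQL A :=
  ⟨fun a z => v a - (⨅ b, v b) - z, ⟨fun a => v a - ⨅ b, v b, fun _ _ => rfl⟩, by
    obtain ⟨a, ha⟩ := exists_eq_ciInf_of_finite (f := v)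
    refine ⟨⟨a, by simp [ha]⟩, ?_⟩
    rintro _ ⟨b, rfl⟩
    have := ciInf_le (Set.finite_range v).bddBelow b
    simp only
    linarith⟩

lemma normalize_apply {A : Type*} [Finite A] [Nonempty A] (v : A → ℝ) (a : A) (z : ℝ) :
    (normalize v : Util A) a z = v a - (⨅ b, v b) - z := rfl

lemma normalize_zero {A : Type*} [Finite A] [Nonempty A] (u : normalizedQL A) :
    normalize (fun a => (u : Util A) a 0) = u := by
  obtain ⟨⟨v, hv⟩, hmin⟩ := u.2
  refine Subtype.ext (funext fun a => funext fun z => ?_)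
  have h0 : (⨅ b, (u : Util A) b 0) = 0 := hmin.csInf_eq
  rw [normalize_apply, h0, hv, hv]
  ring

namespace Mechanism

variable {N A : Type*} [DecidableEq N] {T : N → Set (Pref A)}

/-- The mechanism `M` is incentive compatible for the valuations `val`. -/
def QLIncentiveCompatible (M : Mechanism T) (val : ∀ i, T i → A → ℝ) : Prop :=
  ∀ (i : N) (t : Profile T) (s : T i),
    val i (t i) (M.x (Function.update t i s)) - M.p (Function.update t i s) i ≤
      val i (t i) (M.x t) - M.p t i

lemma IncentiveCompatible.qlIncentiveCompatible {M : Mechanism T} (hIC : M.IncentiveCompatible)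
    (φ : ∀ i, T i → normalizedQL A)
    (hφ : ∀ (i : N) (s : T i), PosRepresents (φ i s : Util A) (s : Pref A))
    (hpay : ∀ (t : Profile T) (i : N), M.p t i ≤ (φ i (t i) : Util A) (M.x t) 0) :
    M.QLIncentiveCompatible fun i s a => (φ i s : Util A) a 0 := by
  intro i t s
  obtain ⟨⟨v, hv⟩, -⟩ := (φ i (t i)).2
  have h0 := hpay t i
  have h1 := (hφ i (t i) (M.x t) (M.x (Function.update t i s)) (M.p t i)
    (M.p (Function.update t i s) i) (Or.inl (by rw [hv] at h0 ⊢; linarith))).1 (hIC i t s)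
  simp only [hv] at h1 ⊢
  linarith

namespace QLIncentiveCompatible

variable {M : Mechanism T} {val : ∀ i, T i → A → ℝ}

/-- The taxation principle: the payment of an agent depends on her own report only through the
chosen alternative. -/
lemma payment_eq (h : M.QLIncentiveCompatible val) {i : N} {t : Profile T} {s : T i}
    (hx : M.x (Function.update t i s) = M.x t) : M.p (Function.update t i s) i = M.p t i := by
  have h1 := h i t s
  have h2 := h i (Function.update t i s) (t i)
  rw [Function.update_idem, Function.update_eq_self, Function.update_self, hx] at h2
  rw [hx] at h1
  linarith

/-- Adding the two incentive constraints between a report and its deviation cancels the payments and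
the normalization constants. -/
lemma weaklyMonotone (h : M.QLIncentiveCompatible val) (τ : ∀ i, (A → ℝ) → T i)
    (hτ : ∀ i v, ∃ k : ℝ, ∀ a, val i (τ i v) a = v a + k) :
    WeaklyMonotone fun v : N → A → ℝ => M.x fun i => τ i (v i) := by
  intro v i s
  have hupd : (fun j => τ j (Function.update v i s j)) =
      Function.update (fun j => τ j (v j)) i (τ i s) := by
    funext j
    exact Function.apply_update (fun j => τ j) v i s j
  simp only [hupd]
  have h1 := h i (fun j => τ j (v j)) (τ i s)
  have h2 := h i (Function.update (fun j => τ j (v j)) i (τ i s)) (τ i (v i))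
  rw [Function.update_idem, Function.update_eq_self_iff.2 rfl, Function.update_self] at h2
  obtain ⟨k, hk⟩ := hτ i (v i)
  obtain ⟨l, hl⟩ := hτ i s
  simp only [hk, hl] at h1 h2
  linarith

/-- Revenue equivalence for affine maximizers. -/
lemma payment_sub_eq [Finite A] (h : M.QLIncentiveCompatible val) (τ : ∀ i, (A → ℝ) → T i)
    (hτ : ∀ i v, ∃ k : ℝ, ∀ a, val i (τ i v) a = v a + k) {i : N} (t : Profile T)
    {r : ℝ} (hr : 0 < r) (q : A → ℝ)
    (hq : ∀ s a, r * val i s a - q a ≤ r * val i s (M.x (Function.update t i s)) -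
      q (M.x (Function.update t i s))) (s : T i) :
    M.p (Function.update t i s) i - q (M.x (Function.update t i s)) / r =
      M.p t i - q (M.x t) / r := by
  classical
  have key : ∀ (s s' : T i),
      M.p (Function.update t i s) i - q (M.x (Function.update t i s)) / r ≤
      M.p (Function.update t i s') i - q (M.x (Function.update t i s')) / r := by
    intro s s'
    by_contra! hlt
    set a := M.x (Function.update t i s) with ha
    set b := M.x (Function.update t i s') with hb
    have hab : b ≠ a := by
      intro hab
      have h1 : M.p (Function.update t i s') i = M.p (Function.update t i s) i := by
        have := h.payment_eq (t := Function.update t i s) (s := s') (by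
          rw [Function.update_idem]; exact hab)
        rwa [Function.update_idem] at this
      rw [hab, h1] at hlt
      exact lt_irrefl _ hlt
    -- A valuation worth `0` at `a`, `m` at `b` and very little elsewhere makes the rule choose `a`,
    -- while at the actual payments the agent gains by the report `s'` that yields `b`.
    obtain ⟨m, hm1, hm2⟩ := exists_between
      (show M.p (Function.update t i s') i - M.p (Function.update t i s) i < q b / r - q a / r by
        linarith)
    obtain ⟨B, hB⟩ := (Set.finite_range fun z => q a / r - q z / r).bddAbove
    set v : A → ℝ := fun z => if z = a then 0 else if z = b then m else -B - 1 with hv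
    have hva : v a = 0 := by simp [hv]
    have hvb : v b = m := by simp [hv, hab]
    obtain ⟨k, hk⟩ := hτ i v
    have hmax : ∀ z, z ≠ a → v z - q z / r < v a - q a / r := by
      intro z hz
      rw [hva]
      by_cases hzb : z = b
      · rw [hzb, hvb]; linarith
      · have h1 : v z = -B - 1 := by simp [hv, hz, hzb]
        have h2 : q a / r - q z / r ≤ B := hB ⟨z, rfl⟩
        rw [h1]; linarith
    have hx : M.x (Function.update t i (τ i v)) = a := by
      by_contra hne
      have h1 := hq (τ i v) a
      have h2 := mul_lt_mul_of_pos_left (hmax _ hne) hr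
      simp only [hk] at h1
      simp only [mul_sub, mul_div_cancel₀ _ hr.ne'] at h2
      linarith
    have hp : M.p (Function.update t i (τ i v)) i = M.p (Function.update t i s) i := by
      have := h.payment_eq (t := Function.update t i s) (s := τ i v) (by
        rw [Function.update_idem]; exact hx)
      rwa [Function.update_idem] at this
    have h3 := h i (Function.update t i (τ i v)) s'
    rw [Function.update_idem, Function.update_self, hx, hp, hk, hk, ← hb, hva, hvb] at h3
    linarith
  have h1 := key s (t i)
  have h2 := key (t i) s
  rw [Function.update_eq_self] at h1 h2
  exact le_antisymm h1 h2

end QLIncentiveCompatible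

lemma eq_update_of_others_eq {i : N} {t t' : Profile T} (h : others i t = others i t') :
    t' = Function.update t i (t' i) := by
  funext j
  by_cases hj : j = i
  · subst hj; simp
  · rw [Function.update_of_ne hj]
    exact (congrFun h ⟨j, hj⟩).symm

lemma NoInfluence.update {M : Mechanism T} {i : N} {t : Profile T} (h : M.NoInfluence i t)
    (s : T i) : M.NoInfluence i (Function.update t i s) := fun r => by
  rw [Function.update_idem, h r, h s]

lemma noInfluence_update_iff {M : Mechanism T} {i : N} {t : Profile T} {s : T i} :
    M.NoInfluence i (Function.update t i s) ↔ M.NoInfluence i t := by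
  refine ⟨fun h => ?_, fun h => h.update s⟩
  simpa using h.update (t i)

end Mechanism

end PosRep


namespace PosRep.Mechanism

/-! ### From affine maximization to VCG payments -/

/-- Affine maximization does not depend on additive constants in the valuations. -/
lemma ChoosesArgmax.of_add_const {N A : Type*} [Fintype N] {T : N → Set (Pref A)}
    {M : Mechanism T} {A' : Set A} {w : N → ℝ} {c : A → ℝ} {u u' : ∀ i, T i → Util A}
    {t : Profile T} (h : M.ChoosesArgmax A' w c u t) (k : ∀ i, T i → ℝ)
    (hk : ∀ i s a, u' i s a 0 = u i s a 0 + k i s) : M.ChoosesArgmax A' w c u' t := by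
  refine ⟨h.1, fun a ha => ?_⟩
  have := h.2 a ha
  simp only [hk, mul_add, Finset.sum_add_distrib]
  linarith

variable {N A : Type*} [Fintype N] [DecidableEq N] {T : N → Set (Pref A)} {M : Mechanism T}

lemma isPosRepVCGUpToNullTies_of_choosesArgmax [Finite A]
    {u₀ : ∀ i, T i → Util A} (hu₀ : IsPosRepSelection u₀)
    (hIC : M.QLIncentiveCompatible fun i s a => u₀ i s a 0) (τ : ∀ i, (A → ℝ) → T i)
    (hτ : ∀ i v, ∃ k : ℝ, ∀ a, u₀ i (τ i v) a 0 = v a + k) {w : N → ℝ} {c : A → ℝ}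
    (hmax : ∀ t, M.ChoosesArgmax Set.univ w c u₀ t) :
    M.IsPosRepVCGUpToNullTies Set.univ w c := by
  classical
  intro u hu
  choose k hk using fun i s =>
    exists_add_const (hu i s).1 (hu i s).2 (hu₀ i s).1 (hu₀ i s).2
  -- The payment formula solved for `h`. The value `0` where a weightless agent has influence is
  -- arbitrary, and having influence depends only on the others' reports.
  set g : ∀ i, Profile T → ℝ := fun i t =>
    if 0 < w i then
      M.p t i + 1 / w i * (c (M.x t) + ∑ j ∈ Finset.univ.erase i, w j * u j (t j) (M.x t) 0)
    else if M.NoInfluence i t then M.p t i else 0 with hg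
  have hfac : ∀ i, (g i).FactorsThrough (others i) := by
    intro i t t' htt'
    rw [eq_update_of_others_eq htt']
    generalize t' i = s
    by_cases hw : 0 < w i
    · have hsum : ∀ (t : Profile T) (a : A),
          ∑ j ∈ Finset.univ.erase i, w j * u j (t j) a 0 =
          ∑ j ∈ Finset.univ.erase i, w j * u₀ j (t j) a 0 +
            ∑ j ∈ Finset.univ.erase i, w j * k j (t j) := fun t a => by
        rw [← Finset.sum_add_distrib]
        exact Finset.sum_congr rfl fun j _ => by rw [hk]; ring
      have hupd : ∀ (F : ∀ j, T j → ℝ) (s : T i),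
          ∑ j ∈ Finset.univ.erase i, F j (Function.update t i s j) =
          ∑ j ∈ Finset.univ.erase i, F j (t j) := fun F s =>
        Finset.sum_congr rfl fun j hj => by rw [Function.update_of_ne (Finset.ne_of_mem_erase hj)]
      have hrev := hIC.payment_sub_eq τ hτ t hw
        (fun a => -(c a + ∑ j ∈ Finset.univ.erase i, w j * u₀ j (t j) a 0)) (fun s a => by
          have h1 := (hmax (Function.update t i s)).2 a trivial
          rw [← Finset.add_sum_erase _ _ (Finset.mem_univ i),
            ← Finset.add_sum_erase _ _ (Finset.mem_univ i),
            hupd (fun j r => w j * u₀ j r a 0),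
            hupd (fun j r => w j * u₀ j r (M.x (Function.update t i s)) 0),
            Function.update_self] at h1
          linarith) s
      simp only [hg, if_pos hw]
      rw [hsum t, hsum (Function.update t i s), hupd (fun j r => w j * k j r),
        hupd (fun j r => w j * u₀ j r (M.x (Function.update t i s)) 0)]
      simp only [div_eq_inv_mul] at hrev
      rw [one_div]
      linear_combination -hrev
    · simp only [hg, if_neg hw, noInfluence_update_iff]
      split_ifs with hno
      · exact (hIC.payment_eq (hno s)).symm
      · rfl
  refine ⟨fun i => Function.extend (others i) (g i) 0, fun t =>
    ⟨(hmax t).of_add_const k hk, fun i hi => ?_⟩⟩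
  unfold vcgPayment
  simp only [(hfac i).extend_apply]
  by_cases hw : 0 < w i
  · simp only [hg, if_pos hw]
    ring
  · simp only [hg, if_neg hw, if_pos (hi.resolve_left hw)]

/-- An agent of weight zero has no influence where the others are not indifferent. -/
lemma exists_noInfluence [Finite A] {u₀ : ∀ i, T i → Util A} (τ : ∀ i, (A → ℝ) → T i)
    (hτ : ∀ i v, ∃ k : ℝ, ∀ a, u₀ i (τ i v) a 0 = v a + k) {w : N → ℝ} {c : A → ℝ}
    (hmax : ∀ t, M.ChoosesArgmax Set.univ w c u₀ t) {i j : N} (hi : w i = 0) (hj : 0 < w j)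
    (b : A) : ∃ t, M.NoInfluence i t := by
  classical
  obtain ⟨B, hB⟩ := (Set.finite_range fun a => c a - c b).bddAbove
  -- Weighted by `w j`, the bonus for `b` is `B + 1`, which outweighs every cost difference; all
  -- other agents except possibly `i`, whose weight is zero, are indifferent.
  set v : N → A → ℝ := fun l a => if l = j ∧ a = b then (B + 1) / w j else 0 with hv
  have hx : ∀ s, M.x (Function.update (fun l => τ l (v l)) i s) = b := by
    intro s
    by_contra hne
    set t := Function.update (fun l => τ l (v l)) i s with ht
    choose k hk using fun l => hτ l (v l)
    have hval : ∀ a, ∑ l, w l * u₀ l (t l) a 0 = w j * v j a + ∑ l, w l * k l := fun a => by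
      rw [← Finset.sum_erase_add _ _ (Finset.mem_univ j),
        ← Finset.sum_erase_add (a := j) Finset.univ (fun l => w l * k l) (Finset.mem_univ j)]
      have h1 : u₀ j (t j) a 0 = v j a + k j := by
        rw [ht, Function.update_of_ne (by rintro rfl; exact hj.ne' hi), hk]
      have h2 : ∑ l ∈ Finset.univ.erase j, w l * u₀ l (t l) a 0 =
          ∑ l ∈ Finset.univ.erase j, w l * k l := Finset.sum_congr rfl fun l hl => by
        by_cases hli : l = i
        · rw [hli, hi, zero_mul, zero_mul]
        · rw [ht, Function.update_of_ne hli, hk]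
          simp [hv, Finset.ne_of_mem_erase hl]
      rw [h1, h2]
      ring
    have h1 := (hmax t).2 b trivial
    rw [hval, hval] at h1
    have h2 : v j b = (B + 1) / w j := by simp [hv]
    have h3 : v j (M.x t) = 0 := by simp [hv, hne]
    have h4 : c (M.x t) - c b ≤ B := hB ⟨_, rfl⟩
    rw [h2, h3, mul_div_cancel₀ _ hj.ne'] at h1
    linarith
  refine ⟨fun l => τ l (v l), fun s => ?_⟩
  have h1 := hx (τ i (v i))
  rw [Function.update_eq_self_iff.2 rfl] at h1
  rw [hx s, h1]

lemma IsPosRepVCGUpToNullTies.isPosRepVCG {A' : Set A} {w : N → ℝ} {c : A → ℝ}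
    (h : M.IsPosRepVCGUpToNullTies A' w c) (hno : ∀ i, ¬ 0 < w i → ∀ t, M.NoInfluence i t) :
    M.IsPosRepVCG A' w c := by
  intro u hu
  obtain ⟨H, hH⟩ := h u hu
  refine ⟨H, fun t => ⟨(hH t).1, fun i => (hH t).2 i ?_⟩⟩
  by_cases hw : 0 < w i
  · exact Or.inl hw
  · exact Or.inr (hno i hw t)

end PosRep.Mechanism

/-! ### Assembly -/

theorem theorem2 {N A : Type*} [Fintype N] [DecidableEq N] [Fintype A]
    (hA : 3 ≤ Fintype.card A)
    (T : N → Set (PosRep.Pref A)) (hT : ∀ i, T i ⊆ PosRep.allTypes A)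
    (φ : ∀ i, T i ≃ PosRep.normalizedQL A)
    (hφ : ∀ (i : N) (s : T i), PosRep.PosRepresents (φ i s : PosRep.Util A) (s : PosRep.Pref A))
    (M : PosRep.Mechanism T) (hIC : M.IncentiveCompatible) (hOnto : M.Onto)
    (hpay : ∀ (t : PosRep.Profile T) (i : N),
      M.p t i ≤ (φ i (t i) : PosRep.Util A) (M.x t) 0) :
    ∃ w ∈ stdSimplex ℝ N, ∃ c : A → ℝ,
      M.IsPosRepVCGUpToNullTies Set.univ w c ∧
      (M.InfluenceDichotomy → M.IsPosRepVCG Set.univ w c) := by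
  have hne : Nonempty A := Fintype.card_pos_iff.1 (by omega)
  set u₀ : ∀ i, T i → PosRep.Util A := fun i s => φ i s with hu₀
  have hsel : PosRep.IsPosRepSelection u₀ := fun i s => ⟨(φ i s).2.1, hφ i s⟩
  have hQL : M.QLIncentiveCompatible fun i s a => u₀ i s a 0 :=
    hIC.qlIncentiveCompatible (fun i => φ i) hφ hpay
  set τ : ∀ i, (A → ℝ) → T i := fun i v => (φ i).symm (PosRep.normalize v) with hτ_def
  have hτ : ∀ i v, ∃ k : ℝ, ∀ a, u₀ i (τ i v) a 0 = v a + k := fun i v =>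
    ⟨-⨅ b, v b, fun a => by
      simp only [hu₀, hτ_def, Equiv.apply_symm_apply, PosRep.normalize_apply]; ring⟩
  have hτ_val : ∀ t : PosRep.Profile T, (fun i => τ i fun a => u₀ i (t i) a 0) = t := fun t => by
    funext i
    simp only [hu₀, hτ_def, PosRep.normalize_zero, Equiv.symm_apply_apply]
  have honto : Function.Surjective fun v : N → A → ℝ => M.x fun i => τ i (v i) := fun a => by
    obtain ⟨t, ht⟩ := hOnto a
    exact ⟨fun i a => u₀ i (t i) a 0, by simp only [hτ_val, ht]⟩
  obtain ⟨w, hw, c, hc⟩ := (hQL.weaklyMonotone τ hτ).exists_affine_maximizer hA honto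
  have hmax : ∀ t, M.ChoosesArgmax Set.univ w c u₀ t := fun t => ⟨trivial, fun a _ => by
    have h1 := hc (fun i a => u₀ i (t i) a 0) a
    simpa only [hτ_val] using h1⟩
  have hVCG := PosRep.Mechanism.isPosRepVCGUpToNullTies_of_choosesArgmax hsel hQL τ hτ hmax
  refine ⟨w, hw, c, hVCG, fun hdich => hVCG.isPosRepVCG fun i hi => hdich i ?_⟩
  obtain ⟨j, -, hj⟩ : ∃ j ∈ Finset.univ, 0 < w j :=
    Finset.exists_lt_of_sum_lt (f := fun _ => (0 : ℝ)) (by simp [hw.2])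
  exact PosRep.Mechanism.exists_noInfluence τ hτ hmax
    (le_antisymm (not_lt.1 hi) (hw.1 i)) hj (Classical.arbitrary A)
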